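/- Let $\Gamma$ be a finitely generated word hyperbolic group, $G$ a semisimple Lie group, $(P^+,P^-)$ a pair of opposite parabolic subgroups of $G$, and $H\le G$ a closed subgroup. For every $(P^+,P^-)$-Anosov representation $\rho:\Gamma\to G$ choose a domain of discontinuity $\Omega_\rho\subseteq G/H$, that is an open $\rho(\Gamma)$-invariant subset such that $\{\gamma\in\Gamma:\rho(\gamma)K\cap K\ne\emptyset\}$ is finite for every compact $K\subseteq\Omega_\rho$; it may be empty. (1) The $(P^+,P^-)$-Anosov representations $\Gamma\to G$ are the objects of a category $\mathbf{An}$ in which a morphism $\rho\to\rho'$ is a group homomorphism $\phi:G\to G$ such that $\phi(\rho(\Gamma))\subseteq\rho'(\Gamma)$ and such that, for all $g,h\in\rho(\Gamma)$, $g|_{\Omega_\rho}=h|_{\Omega_\rho}$ implies $\phi(g)|_{\Omega_{\rho'}}=\phi(h)|_{\Omega_{\rho'}}$; composition and identities are those of homomorphisms. (2) Suppose moreover that every $\Omega_\rho$ carries a complex structure of complex dimension one, compatible with its smooth structure, for which $\rho(\Gamma)$ acts by holomorphic maps. For $g\in\rho(\Gamma)$ let $\mathcal E_\rho^g=g^*T^{1,0}\Omega_\rho=\{(m,x)\in\Omega_\rho\times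 T^{1,0}\Omega_\rho : x\in T^{1,0}_{gm}\Omega_\rho\}$, so that, when $\Omega_\rho\neq\emptyset$, $\mathcal E_\rho^g=\mathcal E_\rho^h$ if and only if $g|_{\Omega_\rho}=h|_{\Omega_\rho}$. Let $F_\rho$ be the free group on the set $\{\mathcal E_\rho^g : g\in\rho(\Gamma)\}$ of line bundles (formal tensor products of the bundles $\mathcal E_\rho^g$ and their duals, with the trivial bundle as the identity and duals as inverses) if $\Omega_\rho\ne\emptyset$, and the trivial group if $\Omega_\rho=\emptyset$. For every morphism $\phi:\rho\to\rho'$ of $\mathbf{An}$ there is a well-defined homomorphism $\mathcal F(\phi):F_\rho\to F_{\rho'}$ with $\mathcal F(\phi)(\mathcal E_\rho^g)=\mathcal E_{\rho'}^{\phi(g)}$ for all $g\in\rho(\Gamma)$ if $\Omega_\rho$ and $\Omega_{\rho'}$ are non-empty, and $\mathcal F(\phi)$ trivial otherwise. One has $\mathcal F(\mathrm{id}_\rho)=\mathrm{id}_{F_\rho}$, and $\mathcal F(\psi\circ\phi)=\mathcal F(\psi)\circ\mathcal F(\phi)$ for all morphisms $\phi:\rho\to\rho'$ and $\psi:\rho'\to\rho''$,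 except possibly when $\Omega_{\rho'}=\emptyset$ while $\Omega_\rho$ and $\Omega_{\rho''}$ are non-empty. In particular, if the domains $\Omega_\rho$ are all non-empty, or all empty, then $\rho\mapsto F_\rho$, $\phi\mapsto\mathcal F(\phi)$ is a covariant functor from $\mathbf{An}$ to the category $\mathbf{Fr}$ of free groups. -/

import Mathlib

open Filter Topology CategoryTheory
open scoped Manifold ContDiff TensorProduct

universe u

noncomputable section

namespace AnosovFree

/-! ### Coarse geometry: Gromov products, hyperbolicity, quasi-isometries, the Gromov boundary

Everything is stated for a distance function `d : α → α → ℝ`, so that it applies both to a metric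
space and to a group with a word metric. -/

section Coarse

variable {α β : Type*}

/-- The Gromov product `(x|y)_o`. -/
def gromovProduct (d : α → α → ℝ) (o x y : α) : ℝ := (d o x + d o y - d x y) / 2

/-- The four-point definition of Gromov hyperbolicity. -/
def IsGromovHyperbolic (d : α → α → ℝ) : Prop :=
  ∃ δ : ℝ, ∀ o x y z : α,
    min (gromovProduct d o x y) (gromovProduct d o y z) - δ ≤ gromovProduct d o x z

def IsQIEmbedding (d : α → α → ℝ) (d' : β → β → ℝ) (f : α → β) : Prop :=
  ∃ K C : ℝ, 1 ≤ K ∧ 0 ≤ C ∧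
    ∀ x y, K⁻¹ * d x y - C ≤ d' (f x) (f y) ∧ d' (f x) (f y) ≤ K * d x y + C

def IsQuasiIsometry (d : α → α → ℝ) (d' : β → β → ℝ) (f : α → β) : Prop :=
  IsQIEmbedding d d' f ∧ ∃ C : ℝ, ∀ z, ∃ x, d' (f x) z ≤ C

/-- `(x_i|y_j)_o → ∞` as `i, j → ∞`. -/
def ProductDiverges (d : α → α → ℝ) (x y : ℕ → α) : Prop :=
  ∀ o, Tendsto (fun p : ℕ × ℕ => gromovProduct d o (x p.1) (y p.2)) atTop atTop

/-- Sequences converging at infinity. -/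
def GromovSeq (d : α → α → ℝ) : Type _ := {x : ℕ → α // ProductDiverges d x x}

/-- The boundary at infinity: sequences converging at infinity, where `x` and `y` are identified
if `(x_i|y_j) → ∞` (this is an equivalence relation when `d` is a hyperbolic metric). -/
def GromovBoundary (d : α → α → ℝ) : Type _ :=
  Quot (fun x y : GromovSeq d => ProductDiverges d x.1 y.1)

/-- The sequence `x` converges to the boundary point `t`. -/
def SeqTendsTo (d : α → α → ℝ) (x : ℕ → α) (t : GromovBoundary d) : Prop :=
  ∃ h : ProductDiverges d x x, Quot.mk _ (⟨x, h⟩ : GromovSeq d) = t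

/-- The basic neighbourhoods `U(t,r)` of a boundary point `t`: those `s` for which there are
sequences `x → t`, `y → s` with `(x_i|y_j)_o ≥ r` for all large `i, j`. -/
def boundaryNhd (d : α → α → ℝ) (o : α) (t : GromovBoundary d) (r : ℝ) :
    Set (GromovBoundary d) :=
  {s | ∃ x y : ℕ → α, SeqTendsTo d x t ∧ SeqTendsTo d y s ∧
    ∀ᶠ p : ℕ × ℕ in atTop, r ≤ gromovProduct d o (x p.1) (y p.2)}

theorem boundaryNhd_anti (d : α → α → ℝ) (o : α) (t : GromovBoundary d) {r r' : ℝ} (h : r ≤ r') :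
    boundaryNhd d o t r' ⊆ boundaryNhd d o t r := by
  rintro s ⟨x, y, hx, hy, hr⟩
  exact ⟨x, y, hx, hy, hr.mono fun p hp => h.trans hp⟩

instance (d : α → α → ℝ) : TopologicalSpace (GromovBoundary d) where
  IsOpen U := ∀ o, ∀ t ∈ U, ∃ r, boundaryNhd d o t r ⊆ U
  isOpen_univ := fun _ _ _ => ⟨0, Set.subset_univ _⟩
  isOpen_inter := by
    rintro U V hU hV o t ⟨htU, htV⟩
    obtain ⟨r, hr⟩ := hU o t htU
    obtain ⟨r', hr'⟩ := hV o t htV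
    exact ⟨max r r', Set.subset_inter
      ((boundaryNhd_anti d o t (le_max_left r r')).trans hr)
      ((boundaryNhd_anti d o t (le_max_right r r')).trans hr')⟩
  isOpen_sUnion := by
    rintro 𝒰 h𝒰 o t ⟨U, hU, htU⟩
    obtain ⟨r, hr⟩ := h𝒰 U hU o t htU
    exact ⟨r, hr.trans (Set.subset_sUnion_of_mem hU)⟩

theorem ProductDiverges.map {d : α → α → ℝ} (f : α ≃ α) (hf : ∀ x y, d (f x) (f y) = d x y)
    {x y : ℕ → α} (h : ProductDiverges d x y) :
    ProductDiverges d (fun n => f (x n)) (fun n => f (y n)) := by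
  intro o
  have key : ∀ a b, gromovProduct d o (f a) (f b) = gromovProduct d (f.symm o) a b := by
    intro a b
    have ha : d o (f a) = d (f.symm o) a := by rw [← hf (f.symm o) a, f.apply_symm_apply]
    have hb : d o (f b) = d (f.symm o) b := by rw [← hf (f.symm o) b, f.apply_symm_apply]
    simp only [gromovProduct, ha, hb, hf]
  simpa only [key] using h (f.symm o)

/-- The map induced on the boundary by a bijective isometry. -/
def boundaryMap {d : α → α → ℝ} (f : α ≃ α) (hf : ∀ x y, d (f x) (f y) = d x y) :
    GromovBoundary d → GromovBoundary d :=
  Quot.map (fun x => ⟨fun n => f (x.1 n), x.2.map f hf⟩) (fun _ _ h => h.map f hf)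

end Coarse

/-! ### Word metrics -/

section Word

variable {Γ : Type*} [Group Γ]

/-- The word length of `g` with respect to the generating set `S`. -/
def wordLength (S : Set Γ) (g : Γ) : ℕ :=
  sInf {k | ∃ l : List Γ, l.length = k ∧ (∀ s ∈ l, s ∈ S ∨ s⁻¹ ∈ S) ∧ l.prod = g}

def wordDist (S : Set Γ) (g h : Γ) : ℝ := wordLength S (g⁻¹ * h)

/-- The boundary at infinity of a group with the word metric of `S`. -/
abbrev GroupBoundary (S : Set Γ) : Type _ := GromovBoundary (wordDist S)

/-- The action of the group on its boundary, induced by left translations. -/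
def boundaryAct (S : Set Γ) (γ : Γ) : GroupBoundary S → GroupBoundary S :=
  boundaryMap (Equiv.mulLeft γ) (fun x y => by simp [wordDist, mul_assoc])

end Word

/-! ### The flow space of a word hyperbolic group -/

/-- A flow space for `Γ`: a proper hyperbolic metric space `Y` with an action of
`Γ × (ℝ ⋊ ℤ/2)`, given by commuting actions of `Γ` and of `ℝ ⋊ ℤ/2`, where `flow` is the action
of `ℝ` and `flip` that of the generator of `ℤ/2`, which acts on `ℝ` by `t ↦ -t`. -/
structure FlowSpace {Γ : Type*} [Group Γ] (S : Set Γ)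
    (Y : Type) [MetricSpace Y] [MulAction Γ Y] where
  proper : ProperSpace Y
  hyperbolic : IsGromovHyperbolic (dist : Y → Y → ℝ)
  flow : ℝ → Y → Y
  flow_zero : ∀ y, flow 0 y = y
  flow_add : ∀ s t y, flow (s + t) y = flow s (flow t y)
  continuous_flow : Continuous fun p : ℝ × Y => flow p.1 p.2
  flip : Y → Y
  flip_flip : ∀ y, flip (flip y) = y
  flip_flow : ∀ t y, flip (flow t y) = flow (-t) (flip y)
  smul_flow : ∀ (γ : Γ) t y, γ • flow t y = flow t (γ • y)
  smul_flip : ∀ (γ : Γ) y, γ • flip y = flip (γ • y)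
  isometry_smul : ∀ γ : Γ, Isometry fun y : Y => γ • y
  isometry_flip : Isometry flip
  /-- Every orbit map of `Γ` is a quasi-isometry. -/
  orbit_quasiIsometry : ∀ y : Y, IsQuasiIsometry (wordDist S) dist fun γ : Γ => γ • y
  /-- The identification of the two boundaries that is induced by the orbit maps. -/
  boundaryHomeo : GroupBoundary S ≃ₜ GromovBoundary (dist : Y → Y → ℝ)
  boundaryHomeo_spec : ∀ (x : ℕ → Γ) (t : GroupBoundary S) (y : Y), SeqTendsTo (wordDist S) x t →
    SeqTendsTo dist (fun k => x k • y) (boundaryHomeo t)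
  flow_free : ∀ t y, flow t y = y → t = 0
  flow_orbit : ∀ y, IsQIEmbedding (dist : ℝ → ℝ → ℝ) dist fun t => flow t y
  /-- The forward endpoint of the flow line of a point. -/
  endPlus : Y → GromovBoundary (dist : Y → Y → ℝ)
  endPlus_spec : ∀ y, SeqTendsTo dist (fun k : ℕ => flow k y) (endPlus y)
  /-- The backward endpoint of the flow line of a point. -/
  endMinus : Y → GromovBoundary (dist : Y → Y → ℝ)
  endMinus_spec : ∀ y, SeqTendsTo dist (fun k : ℕ => flow (-k) y) (endMinus y)
  /-- The endpoint maps induce a homeomorphism from the space of flow lines onto the space of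
  pairs of distinct boundary points. -/
  endpoints_homeo : ∃ e : Quot (fun y z : Y => ∃ t, z = flow t y) ≃ₜ
      {p : GromovBoundary (dist : Y → Y → ℝ) × GromovBoundary (dist : Y → Y → ℝ) // p.1 ≠ p.2},
    ∀ y, (e (Quot.mk _ y)).1 = (endPlus y, endMinus y)

namespace FlowSpace

variable {Γ : Type*} [Group Γ] {S : Set Γ} {Y : Type} [MetricSpace Y] [MulAction Γ Y]

/-- `τ⁺ : Y → ∂Γ`. -/
def tauPlus (F : FlowSpace S Y) (y : Y) : GroupBoundary S := F.boundaryHomeo.symm (F.endPlus y)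

/-- `τ⁻ : Y → ∂Γ`. -/
def tauMinus (F : FlowSpace S Y) (y : Y) : GroupBoundary S := F.boundaryHomeo.symm (F.endMinus y)

end FlowSpace

/-! ### Lie groups, the adjoint representation, parabolic subgroups -/

instance : ENat.LEInfty (minSmoothness ℝ 3) where
  out := by
    rw [minSmoothness_of_isRCLikeNormedField]
    exact (inferInstance : ENat.LEInfty 3).out

section Lie

variable {n : ℕ} {G : Type*} [TopologicalSpace G] [ChartedSpace (EuclideanSpace ℝ (Fin n)) G]
  [Group G] [LieGroup (𝓡 n) ∞ G]

variable (n G) in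
/-- The Lie algebra of `G`. -/
abbrev LieAlg : Type := GroupLieAlgebra (𝓡 n) G

/-- `Ad g`, the differential at the identity of the conjugation by `g`. -/
def Ad (g : G) : LieAlg n G →L[ℝ] LieAlg n G :=
  mfderiv (𝓡 n) (𝓡 n) (fun x : G => g * x * g⁻¹) (1 : G)

theorem Ad_one : (Ad (1 : G) : LieAlg n G →L[ℝ] LieAlg n G) = ContinuousLinearMap.id ℝ _ := by
  have : (fun x : G => 1 * x * 1⁻¹) = id := by ext x; simp
  unfold Ad
  rw [this]
  exact mfderiv_id

theorem mdifferentiable_conj (g x : G) :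
    MDifferentiableAt (𝓡 n) (𝓡 n) (fun x : G => g * x * g⁻¹) x := by
  have h : ContMDiff (𝓡 n) (𝓡 n) ∞ (fun x : G => g * x * g⁻¹) :=
    (contMDiff_const.mul contMDiff_id).mul contMDiff_const
  exact (h x).mdifferentiableAt (by simp)

theorem Ad_mul (g h : G) : (Ad (g * h) : LieAlg n G →L[ℝ] LieAlg n G) = (Ad g).comp (Ad h) := by
  have hc : (fun x : G => g * h * x * (g * h)⁻¹) =
      (fun x : G => g * x * g⁻¹) ∘ (fun x : G => h * x * h⁻¹) := by
    ext x; simp [mul_assoc]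
  have h1 : h * 1 * h⁻¹ = 1 := by simp
  have H1 := (mdifferentiable_conj (n := n) h (1 : G)).hasMFDerivAt
  have H2 := (mdifferentiable_conj (n := n) g (h * 1 * h⁻¹)).hasMFDerivAt
  have H := (HasMFDerivAt.comp (1 : G) H2 H1).mfderiv
  unfold Ad
  rw [hc]
  refine H.trans ?_
  rw [h1]
  rfl

/-- `X` is hyperbolic: `ad X` is diagonalizable over `ℝ`. -/
def IsHyperbolicElement (X : LieAlg n G) : Prop :=
  ⨆ μ : ℝ, Module.End.eigenspace (LieAlgebra.ad ℝ (LieAlg n G) X) μ = ⊤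

/-- The sum of the eigenspaces of `ad X` for the eigenvalues `μ ≥ 0`. -/
def parabolicAlg (X : LieAlg n G) : Submodule ℝ (LieAlg n G) :=
  ⨆ μ : ℝ, ⨆ _ : 0 ≤ μ, Module.End.eigenspace (LieAlgebra.ad ℝ (LieAlg n G) X) μ

/-- The normalizer in `G` of `parabolicAlg X`. -/
def parabolic (X : LieAlg n G) : Subgroup G where
  carrier := {g | (parabolicAlg X).map (Ad g).toLinearMap = parabolicAlg X}
  one_mem' := by
    change (parabolicAlg X).map (Ad (1 : G)).toLinearMap = parabolicAlg X
    rw [Ad_one]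
    exact Submodule.map_id _
  mul_mem' := by
    intro a b ha hb
    change (parabolicAlg X).map (Ad (a * b)).toLinearMap = parabolicAlg X
    rw [Ad_mul, ContinuousLinearMap.toLinearMap_comp, Submodule.map_comp]
    rw [show (parabolicAlg X).map (Ad b).toLinearMap = parabolicAlg X from hb]
    exact ha
  inv_mem' := by
    intro a ha
    change (parabolicAlg X).map (Ad a⁻¹).toLinearMap = parabolicAlg X
    conv_lhs => rw [← show (parabolicAlg X).map (Ad a).toLinearMap = parabolicAlg X from ha]
    rw [← Submodule.map_comp, ← ContinuousLinearMap.toLinearMap_comp, ← Ad_mul, inv_mul_cancel,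
      Ad_one]
    exact Submodule.map_id _

variable (n G) in
/-- A pair of opposite parabolic subgroups of a semisimple Lie group, given by a hyperbolic element
`X` of the Lie algebra: if `X` lies in a closed Weyl chamber and `Θ` is the set of the simple roots
that are positive at `X`, then `plus` and `minus` are the normalizers of the sums of the root spaces
(with the centralizer of the Cartan subspace) on which `ad X` is `≥ 0`, respectively `≤ 0`, that is
the standard pair `P_Θ⁺`, `P_Θ⁻`. -/
structure OppositeParabolicPair where
  X : LieAlg n G
  hyperbolic : IsHyperbolicElement X

namespace OppositeParabolicPair

/-- `P⁺`. -/
def plus (P : OppositeParabolicPair n G) : Subgroup G := parabolic P.X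

/-- `P⁻`. -/
def minus (P : OppositeParabolicPair n G) : Subgroup G := parabolic (-P.X)

end OppositeParabolicPair

/-! ### Anosov representations -/

/-- The exponential contraction condition for the flow in the time direction `ε = ±1` on the
bundle over `Y` with fibre `T_{pt y}(G/Q)`, where `𝔮` is the Lie algebra of `Q`.
The tangent space of `G/Q` at `gQ` is `𝔤 / Ad(g)𝔮`, and `h ∈ G` acts on tangent vectors through
`Ad h`. So a norm on `T_{gQ}(G/Q)` is a seminorm on `𝔤` with null space `Ad(g)𝔮`. -/
def Contracts {Γ : Type*} [Group Γ] {S : Set Γ} {Y : Type} [MetricSpace Y] [MulAction Γ Y]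
    (F : FlowSpace S Y) (ρ : Γ →* G) (Q : Subgroup G) (𝔮 : Submodule ℝ (LieAlg n G))
    (pt : Y → G ⧸ Q) (ε : ℝ) : Prop :=
  ∃ N : Y → Seminorm ℝ (LieAlg n G),
    (Continuous fun p : Y × LieAlg n G => N p.1 p.2) ∧
    (∀ (y : Y) (g : G), pt y = QuotientGroup.mk g →
      ∀ v, N y v = 0 ↔ v ∈ 𝔮.map (Ad g).toLinearMap) ∧
    (∀ (γ : Γ) (y : Y) (v : LieAlg n G), N (γ • y) (Ad (ρ γ) v) = N y v) ∧
    ∃ A a : ℝ, 0 < A ∧ 0 < a ∧ ∀ t : ℝ, 0 ≤ t → ∀ (y : Y) (v : LieAlg n G),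
      N (F.flow (ε * t) y) v ≤ A * Real.exp (-a * t) * N y v

/-- `(P⁺,P⁻)`-Anosov representations of the word hyperbolic group `Γ`, whose finite generating set
is `S`. -/
def IsAnosov {Γ : Type*} [Group Γ] (S : Set Γ) (P : OppositeParabolicPair n G) (ρ : Γ →* G) :
    Prop :=
  ∃ (ξp : GroupBoundary S → G ⧸ P.plus) (ξm : GroupBoundary S → G ⧸ P.minus),
    Continuous ξp ∧ Continuous ξm ∧
    (∀ γ t, ξp (boundaryAct S γ t) = ρ γ • ξp t) ∧
    (∀ γ t, ξm (boundaryAct S γ t) = ρ γ • ξm t) ∧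
    (∀ s t, s ≠ t → ∃ g : G, ξp s = QuotientGroup.mk g ∧ ξm t = QuotientGroup.mk g) ∧
    ∃ (Y : Type) (_ : MetricSpace Y) (_ : MulAction Γ Y) (F : FlowSpace S Y),
      Contracts F ρ P.plus (parabolicAlg P.X) (fun y => ξp (F.tauPlus y)) (-1) ∧
      Contracts F ρ P.minus (parabolicAlg (-P.X)) (fun y => ξm (F.tauMinus y)) 1

/-- The `(P⁺,P⁻)`-Anosov representations `Γ → G`. -/
structure AnosovRep {Γ : Type*} [Group Γ] (S : Set Γ) (P : OppositeParabolicPair n G) where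
  rep : Γ →* G
  anosov : IsAnosov S P rep

/-! ### Domains of discontinuity of complex dimension one -/

/-- A domain of discontinuity in `G/H` for a representation `ρ`. -/
structure DiscontinuityDomain {Γ : Type*} [Group Γ] (H : Subgroup G) (ρ : Γ →* G) where
  carrier : TopologicalSpace.Opens (G ⧸ H)
  invariant : ∀ (γ : Γ), ∀ x ∈ carrier, ρ γ • x ∈ carrier
  finite : ∀ K : Set (G ⧸ H), IsCompact K → K ⊆ carrier →
    {γ : Γ | (((fun x => ρ γ • x) '' K) ∩ K).Nonempty}.Finite

namespace DiscontinuityDomain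

variable {Γ : Type*} [Group Γ] {H : Subgroup G} {ρ : Γ →* G}

/-- The action of an element of `ρ(Γ)` on the domain. -/
def act (D : DiscontinuityDomain H ρ) (g : ρ.range) (x : D.carrier) : D.carrier :=
  ⟨(g : G) • (x : G ⧸ H), by
    obtain ⟨_, γ, rfl⟩ := g
    exact D.invariant γ _ x.2⟩

/-- The open set of all `g ∈ G` with `gH` in the domain. -/
def preimage (D : DiscontinuityDomain H ρ) : TopologicalSpace.Opens G :=
  ⟨QuotientGroup.mk ⁻¹' (D.carrier : Set (G ⧸ H)),
    D.carrier.isOpen.preimage continuous_quotient_mk'⟩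

/-- The restriction of the projection `G → G/H` to the domain. -/
def proj (D : DiscontinuityDomain H ρ) (g : D.preimage) : D.carrier :=
  ⟨QuotientGroup.mk (g : G), g.2⟩

end DiscontinuityDomain

/-- A structure of a complex manifold of complex dimension one on a domain of discontinuity `D` in
`G/H`: it induces the smooth structure of `D` as an open subset of `G/H` (the one for which the
projection from `G` is a smooth submersion), and `ρ(Γ)` acts on `D` by holomorphic maps. -/
structure SurfaceStructure (n : ℕ) {G : Type*} [TopologicalSpace G]
    [ChartedSpace (EuclideanSpace ℝ (Fin n)) G] [Group G]
    {Γ : Type*} [Group Γ] {H : Subgroup G} {ρ : Γ →* G} (D : DiscontinuityDomain H ρ) where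
  charted : ChartedSpace ℂ D.carrier
  isManifold : IsManifold 𝓘(ℂ, ℂ) ω D.carrier
  contMDiff_proj : ContMDiff (𝓡 n) 𝓘(ℝ, ℂ) ∞ D.proj
  submersion_proj : ∀ g, Function.Surjective (mfderiv (𝓡 n) 𝓘(ℝ, ℂ) D.proj g)
  holomorphic_act : ∀ g, ContMDiff 𝓘(ℂ, ℂ) 𝓘(ℂ, ℂ) ω (D.act g)

end Lie

/-! ### The pullbacks of the holomorphic tangent bundle -/

section Bundle

variable {M : Type*} [TopologicalSpace M] [ChartedSpace ℂ M]

/-- The complex structure `J` of the tangent space, as a real linear map. -/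
def tangentJ (m : M) : TangentSpace 𝓘(ℂ, ℂ) m →ₗ[ℝ] TangentSpace 𝓘(ℂ, ℂ) m where
  toFun v := Complex.I • v
  map_add' := smul_add _
  map_smul' _ _ := smul_comm _ _ _

/-- `T^{1,0}_m M`, the eigenspace of `J` for the eigenvalue `i` in the complexified tangent
space. -/
def holTangent (m : M) : Submodule ℂ (ℂ ⊗[ℝ] TangentSpace 𝓘(ℂ, ℂ) m) :=
  Module.End.eigenspace ((tangentJ m).baseChange ℂ) Complex.I

variable (M) in
/-- The total space of `T^{1,0} M`. -/
def HolTangentBundle : Type _ := Σ m : M, holTangent m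

/-- The pullback `f^* T^{1,0} M = {(m, x) ∈ M × T^{1,0} M : x ∈ T^{1,0}_{f(m)} M}`. -/
def pullbackBundle (f : M → M) : Set (M × HolTangentBundle M) := {p | p.2.1 = f p.1}

end Bundle

/-! ### The free group of a representation and the morphisms between representations -/

section FreeGroups

variable {n : ℕ} {G : Type*} [TopologicalSpace G] [ChartedSpace (EuclideanSpace ℝ (Fin n)) G]
  [Group G] {Γ : Type*} [Group Γ] {H : Subgroup G}

/-- `φ : G → G` maps `ρ(Γ)` into `ρ'(Γ)`, and maps elements of `ρ(Γ)` with the same action on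
the domain of `ρ` to elements with the same action on the domain of `ρ'`. -/
structure IsMorphism {G : Type*} [TopologicalSpace G] [Group G] {Γ : Type*} [Group Γ]
    {H : Subgroup G} {ρ ρ' : Γ →* G} (D : DiscontinuityDomain H ρ) (D' : DiscontinuityDomain H ρ')
    (φ : G →* G) : Prop where
  map_range : ∀ g ∈ ρ.range, φ g ∈ ρ'.range
  map_agree : ∀ g h : ρ.range, (∀ x, D.act g x = D.act h x) →
    ∀ x, D'.act ⟨φ g, map_range g g.2⟩ x = D'.act ⟨φ h, map_range h h.2⟩ x

variable {ρ ρ' : Γ →* G} {D : DiscontinuityDomain H ρ} {D' : DiscontinuityDomain H ρ'}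

/-- The total space of `T^{1,0} Ω` for a domain of discontinuity `Ω`. -/
def domainTangent (C : SurfaceStructure n D) : Type _ :=
  letI := C.charted
  HolTangentBundle D.carrier

/-- The holomorphic line bundle `𝓔^g = g^* T^{1,0} Ω` over the domain `Ω`, for `g ∈ ρ(Γ)`.
Elements of `ρ(Γ)` with the same action on `Ω` have the same pullback, holomorphic structure
included, and elements with different actions have different pullbacks. -/
def lineBundle (C : SurfaceStructure n D) (g : ρ.range) : Set (D.carrier × domainTangent C) :=
  letI := C.charted
  pullbackBundle (D.act g)

/-- The set of the bundles `𝓔^g`, `g ∈ ρ(Γ)`. Over the empty domain there is only the trivial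
bundle, so that there are no generators. -/
def bundleSet (C : SurfaceStructure n D) : Set (Set (D.carrier × domainTangent C)) :=
  {B | Nonempty D.carrier ∧ ∃ g : ρ.range, B = lineBundle C g}

/-- The group `F_ρ` of the formal tensor products of the bundles `𝓔^g` and their duals, that is the
free group on the set of the bundles `𝓔^g`; inverses are duals, and the identity is the trivial
bundle. It is the trivial group if the domain is empty. -/
abbrev bundleGroup (C : SurfaceStructure n D) : Type _ := FreeGroup (bundleSet C)

/-- The bundle `𝓔^g` as an element of `F_ρ`. -/
def bundleGen (C : SurfaceStructure n D) (hD : Nonempty D.carrier) (g : ρ.range) :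
    bundleGroup C :=
  FreeGroup.of ⟨lineBundle C g, hD, g, rfl⟩

/-- The category of free groups, as a full subcategory of the category of groups. -/
abbrev FreeGrp : Type _ := ObjectProperty.FullSubcategory fun K : GrpCat => IsFreeGroup K

/-- `F_ρ` as an object of the category of free groups. -/
def freeGrpObj (C : SurfaceStructure n D) : FreeGrp :=
  ⟨GrpCat.of (bundleGroup C), inferInstanceAs (IsFreeGroup (FreeGroup (bundleSet C)))⟩

/-- A homomorphism `F_ρ → F_ρ'` as a morphism of the category of free groups. -/
def freeGrpHom {C : SurfaceStructure n D} {C' : SurfaceStructure n D'}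
    (f : bundleGroup C →* bundleGroup C') : freeGrpObj C ⟶ freeGrpObj C' :=
  ObjectProperty.homMk (GrpCat.ofHom f)

end FreeGroups

end AnosovFree

end

/-!
The category consists of the group homomorphisms satisfying `IsMorphism`, a condition that holds for
the identity and is stable under composition; it makes sense for empty domains too.

The homomorphism of free groups attached to a morphism `φ` is defined on generators by
`𝓔^g ↦ 𝓔^{φ g}`. It is well defined because the bundle `𝓔^g` determines the action of `g` on the
domain (`lineBundle_eq_iff`): the fibre of `𝓔^g` over `m` lies in `T^{1,0}` at `g m`, and it is not
empty, as it contains the zero vector. So `𝓔^g = 𝓔^h` forces `g` and `h` to act alike, hence `φ g`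
and `φ h` to act alike, hence `𝓔^{φ g} = 𝓔^{φ h}`.

If one of the two domains is empty, the homomorphism is trivial. Functoriality can be tested on
generators; it is therefore clear for non-empty domains, and it holds trivially when the source or
the target of the composite has an empty domain. Only an empty domain in the middle, between two
non-empty ones, has to be excluded.
-/

noncomputable section

namespace AnosovFree

section BundleMap

variable {n : ℕ} {G : Type*} [TopologicalSpace G] [ChartedSpace (EuclideanSpace ℝ (Fin n)) G]
  [Group G] {Γ : Type*} [Group Γ] {H : Subgroup G} {ρ ρ' ρ'' : Γ →* G}
  {D : DiscontinuityDomain H ρ} {D' : DiscontinuityDomain H ρ'} {D'' : DiscontinuityDomain H ρ''}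

/-- The fibre of `f^* T^{1,0} M` over `m` lies over `f m`, so the total space determines `f`. -/
theorem pullbackBundle_injective {M : Type*} [TopologicalSpace M] [ChartedSpace ℂ M] :
    Function.Injective (pullbackBundle : (M → M) → Set (M × HolTangentBundle M)) := by
  intro f f' h
  funext m
  -- The zero vector over `m` witnesses that the fibre over `m` is not empty.
  have hm : ((m, ⟨f m, 0⟩) : M × HolTangentBundle M) ∈ pullbackBundle f' := by
    rw [← h]
    rfl
  exact hm

theorem lineBundle_eq_iff (C : SurfaceStructure n D) (g h : ρ.range) :
    lineBundle C g = lineBundle C h ↔ ∀ x, D.act g x = D.act h x := by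
  let := C.charted
  exact pullbackBundle_injective.eq_iff.trans funext_iff

theorem bundleGen_eq_of_act_eq (C : SurfaceStructure n D) (hD : Nonempty D.carrier)
    {g h : ρ.range} (hgh : ∀ x, D.act g x = D.act h x) : bundleGen C hD g = bundleGen C hD h :=
  congrArg FreeGroup.of (Subtype.ext ((lineBundle_eq_iff C g h).2 hgh))

theorem isEmpty_bundleSet (C : SurfaceStructure n D) (hD : IsEmpty D.carrier) :
    IsEmpty (bundleSet C) :=
  ⟨fun B => not_nonempty_iff.2 hD B.2.1⟩

theorem bundleGroup_hom_eq_one (C : SurfaceStructure n D) (hD : IsEmpty D.carrier)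
    {K : Type*} [Group K] (f : bundleGroup C →* K) : f = 1 := by
  have := isEmpty_bundleSet C hD
  exact FreeGroup.ext_hom _ _ isEmptyElim

/-- Homomorphisms on `F_ρ` agree if they agree on the bundles `𝓔^g`. -/
theorem bundleGroup_hom_ext (C : SurfaceStructure n D) (hD : Nonempty D.carrier)
    {K : Type*} [Group K] {f f' : bundleGroup C →* K}
    (h : ∀ g, f (bundleGen C hD g) = f' (bundleGen C hD g)) : f = f' := by
  refine FreeGroup.ext_hom _ _ ?_
  rintro ⟨_, _, g, rfl⟩
  exact h g

theorem IsMorphism.id (D : DiscontinuityDomain H ρ) : IsMorphism D D (MonoidHom.id G) :=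
  ⟨fun _ hg => hg, fun _ _ hgh => hgh⟩

theorem IsMorphism.comp {φ ψ : G →* G} (hψ : IsMorphism D' D'' ψ) (hφ : IsMorphism D D' φ) :
    IsMorphism D D'' (ψ.comp φ) :=
  ⟨fun g hg => hψ.map_range _ (hφ.map_range g hg),
    fun g h hgh => hψ.map_agree ⟨φ g, hφ.map_range g g.2⟩ ⟨φ h, hφ.map_range h h.2⟩
      (hφ.map_agree g h hgh)⟩

open Classical in
/-- The homomorphism `F_ρ → F_ρ'` with `𝓔^g ↦ 𝓔^{φ g}`, defined through a choice, for every bundle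
in the generating set, of an element `g` with that bundle. It is trivial if the domain of `ρ'` is
empty, and, for want of generators, if the domain of `ρ` is empty. -/
def bundleMap (C : SurfaceStructure n D) (C' : SurfaceStructure n D') {φ : G →* G}
    (hφ : IsMorphism D D' φ) : bundleGroup C →* bundleGroup C' :=
  if h' : Nonempty D'.carrier then
    FreeGroup.lift fun B : bundleSet C =>
      bundleGen C' h' ⟨φ B.2.2.choose, hφ.map_range _ B.2.2.choose.2⟩
  else 1

theorem bundleMap_bundleGen (C : SurfaceStructure n D) (C' : SurfaceStructure n D') {φ : G →* G}
    (hφ : IsMorphism D D' φ) (h : Nonempty D.carrier) (h' : Nonempty D'.carrier) (g : ρ.range) :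
    bundleMap C C' hφ (bundleGen C h g) =
      bundleGen C' h' ⟨φ g, hφ.map_range g g.2⟩ := by
  have hB : ∃ k : ρ.range, lineBundle C g = lineBundle C k := ⟨g, rfl⟩
  rw [bundleMap, dif_pos h']
  refine (FreeGroup.lift_apply_of ..).trans ?_
  exact bundleGen_eq_of_act_eq C' h'
    (hφ.map_agree _ _ ((lineBundle_eq_iff C _ _).1 hB.choose_spec.symm))

theorem bundleMap_eq_one (C : SurfaceStructure n D) (C' : SurfaceStructure n D') {φ : G →* G}
    (hφ : IsMorphism D D' φ) (h : IsEmpty D.carrier ∨ IsEmpty D'.carrier) :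
    bundleMap C C' hφ = 1 := by
  rcases h with h | h
  · exact bundleGroup_hom_eq_one C h _
  · exact dif_neg (not_nonempty_iff.2 h)

theorem bundleMap_id (C : SurfaceStructure n D) :
    bundleMap C C (IsMorphism.id D) = MonoidHom.id _ := by
  rcases isEmpty_or_nonempty D.carrier with h | h
  · exact (bundleGroup_hom_eq_one C h _).trans (bundleGroup_hom_eq_one C h _).symm
  · exact bundleGroup_hom_ext C h fun g => bundleMap_bundleGen C C (IsMorphism.id D) h h g

theorem bundleMap_comp (C : SurfaceStructure n D) (C' : SurfaceStructure n D')
    (C'' : SurfaceStructure n D'') {φ ψ : G →* G} (hψ : IsMorphism D' D'' ψ)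
    (hφ : IsMorphism D D' φ)
    (hD : IsEmpty D'.carrier → IsEmpty D.carrier ∨ IsEmpty D''.carrier) :
    bundleMap C C'' (hψ.comp hφ) = (bundleMap C' C'' hψ).comp (bundleMap C C' hφ) := by
  rcases isEmpty_or_nonempty D.carrier with h | h
  · exact (bundleGroup_hom_eq_one C h _).trans (bundleGroup_hom_eq_one C h _).symm
  rcases isEmpty_or_nonempty D''.carrier with h'' | h''
  · rw [bundleMap_eq_one C C'' _ (Or.inr h''), bundleMap_eq_one C' C'' _ (Or.inr h''),
      MonoidHom.one_comp]
  have h' : Nonempty D'.carrier := by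
    by_contra he
    rcases hD (not_nonempty_iff.1 he) with h0 | h0
    · exact not_nonempty_iff.2 h0 h
    · exact not_nonempty_iff.2 h0 h''
  refine bundleGroup_hom_ext C h fun g => ?_
  rw [MonoidHom.comp_apply, bundleMap_bundleGen C C' hφ h h', bundleMap_bundleGen C' C'' hψ h' h'',
    bundleMap_bundleGen C C'' (hψ.comp hφ) h h'']
  rfl

theorem freeGrpHom_id (C : SurfaceStructure n D) :
    freeGrpHom (MonoidHom.id (bundleGroup C)) = 𝟙 (freeGrpObj C) :=
  rfl

theorem freeGrpHom_comp {C : SurfaceStructure n D} {C' : SurfaceStructure n D'}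
    {C'' : SurfaceStructure n D''} (f : bundleGroup C →* bundleGroup C')
    (f' : bundleGroup C' →* bundleGroup C'') :
    freeGrpHom (f'.comp f) = freeGrpHom f ≫ freeGrpHom f' :=
  rfl

end BundleMap

/-- The category of the Anosov representations, for a choice `Ω` of domains of discontinuity. -/
abbrev anosovCategory {n : ℕ} {G : Type u} [TopologicalSpace G]
    [ChartedSpace (EuclideanSpace ℝ (Fin n)) G] [Group G] [LieGroup (𝓡 n) ∞ G]
    {Γ : Type*} [Group Γ] {S : Set Γ} {P : OppositeParabolicPair n G} {H : Subgroup G}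
    (Ω : ∀ ρ : AnosovRep S P, DiscontinuityDomain H ρ.rep) : Category.{u} (AnosovRep S P) where
  Hom ρ ρ' := {φ : G →* G // IsMorphism (Ω ρ) (Ω ρ') φ}
  id ρ := ⟨MonoidHom.id G, IsMorphism.id (Ω ρ)⟩
  comp f g := ⟨g.1.comp f.1, g.2.comp f.2⟩

end AnosovFree

end

theorem mainTheorem7
    {n : ℕ} {G : Type u} [TopologicalSpace G] [T2Space G] [SecondCountableTopology G]
    [ChartedSpace (EuclideanSpace ℝ (Fin n)) G] [Group G] [LieGroup (𝓡 n) ∞ G]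
    [LieAlgebra.IsSemisimple ℝ (AnosovFree.LieAlg n G)]
    {Γ : Type*} [Group Γ] (S : Set Γ) (hS : S.Finite) (hSgen : Subgroup.closure S = ⊤)
    (hΓ : AnosovFree.IsGromovHyperbolic (AnosovFree.wordDist S))
    (P : AnosovFree.OppositeParabolicPair n G)
    (H : Subgroup G) (hH : IsClosed (H : Set G))
    (Ω : ∀ ρ : AnosovFree.AnosovRep S P, AnosovFree.DiscontinuityDomain H ρ.rep) :
    ∃ (An : Category.{u} (AnosovFree.AnosovRep S P))
      (hom : ∀ ρ ρ' : AnosovFree.AnosovRep S P,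
        (ρ ⟶ ρ') ≃ {φ : G →* G // AnosovFree.IsMorphism (Ω ρ) (Ω ρ') φ}),
      (∀ ρ, (hom ρ ρ (𝟙 ρ)).1 = MonoidHom.id G) ∧
      (∀ (ρ ρ' ρ'' : AnosovFree.AnosovRep S P) (f : ρ ⟶ ρ') (g : ρ' ⟶ ρ''),
        (hom ρ ρ'' (f ≫ g)).1 = (hom ρ' ρ'' g).1.comp (hom ρ ρ' f).1) ∧
      ∀ C : ∀ ρ, AnosovFree.SurfaceStructure n (Ω ρ),
        ∃ F : ∀ ρ ρ' : AnosovFree.AnosovRep S P, (ρ ⟶ ρ') →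
            (AnosovFree.bundleGroup (C ρ) →* AnosovFree.bundleGroup (C ρ')),
          (∀ (ρ ρ' : AnosovFree.AnosovRep S P) (f : ρ ⟶ ρ') (h : Nonempty (Ω ρ).carrier)
            (h' : Nonempty (Ω ρ').carrier) (g : ρ.rep.range),
            F ρ ρ' f (AnosovFree.bundleGen (C ρ) h g) =
              AnosovFree.bundleGen (C ρ') h'
                ⟨(hom ρ ρ' f).1 g, (hom ρ ρ' f).2.map_range g g.2⟩) ∧
          (∀ (ρ ρ' : AnosovFree.AnosovRep S P) (f : ρ ⟶ ρ'),
            IsEmpty (Ω ρ).carrier ∨ IsEmpty (Ω ρ').carrier → F ρ ρ' f = 1) ∧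
          (∀ ρ, F ρ ρ (𝟙 ρ) = MonoidHom.id _) ∧
          (∀ (ρ ρ' ρ'' : AnosovFree.AnosovRep S P) (f : ρ ⟶ ρ') (g : ρ' ⟶ ρ''),
            (IsEmpty (Ω ρ').carrier → IsEmpty (Ω ρ).carrier ∨ IsEmpty (Ω ρ'').carrier) →
            F ρ ρ'' (f ≫ g) = (F ρ' ρ'' g).comp (F ρ ρ' f)) ∧
          (((∀ ρ, Nonempty (Ω ρ).carrier) ∨ (∀ ρ, IsEmpty (Ω ρ).carrier)) →
            ∃ (Fun : AnosovFree.AnosovRep S P ⥤ AnosovFree.FreeGrp)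
              (hobj : ∀ ρ, Fun.obj ρ = AnosovFree.freeGrpObj (C ρ)),
              ∀ (ρ ρ' : AnosovFree.AnosovRep S P) (f : ρ ⟶ ρ'),
                Fun.map f = eqToHom (hobj ρ) ≫ AnosovFree.freeGrpHom (F ρ ρ' f) ≫
                  eqToHom (hobj ρ').symm) := by
  let An := AnosovFree.anosovCategory Ω
  let F (C : ∀ ρ, AnosovFree.SurfaceStructure n (Ω ρ)) (ρ ρ' : AnosovFree.AnosovRep S P)
      (f : ρ ⟶ ρ') : AnosovFree.bundleGroup (C ρ) →* AnosovFree.bundleGroup (C ρ') :=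
    AnosovFree.bundleMap (C ρ) (C ρ') f.2
  have F_comp (C : ∀ ρ, AnosovFree.SurfaceStructure n (Ω ρ)) (ρ ρ' ρ'' : AnosovFree.AnosovRep S P)
      (f : ρ ⟶ ρ') (g : ρ' ⟶ ρ'')
      (hE : IsEmpty (Ω ρ').carrier → IsEmpty (Ω ρ).carrier ∨ IsEmpty (Ω ρ'').carrier) :
      F C ρ ρ'' (f ≫ g) = (F C ρ' ρ'' g).comp (F C ρ ρ' f) :=
    AnosovFree.bundleMap_comp (C ρ) (C ρ') (C ρ'') g.2 f.2 hE
  refine ⟨An, fun _ _ => Equiv.refl _, fun _ => rfl, fun _ _ _ _ _ => rfl, fun C => ⟨F C,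
    fun ρ ρ' f h h' g => AnosovFree.bundleMap_bundleGen (C ρ) (C ρ') f.2 h h' g,
    fun ρ ρ' f h => AnosovFree.bundleMap_eq_one (C ρ) (C ρ') f.2 h,
    fun ρ => AnosovFree.bundleMap_id (C ρ), F_comp C, fun hΩ => ?_⟩⟩
  -- In both cases the excluded configuration, an empty domain between non-empty ones, is absent.
  have hE (ρ ρ' : AnosovFree.AnosovRep S P) (h : IsEmpty (Ω ρ').carrier) :
      IsEmpty (Ω ρ).carrier :=
    hΩ.elim (fun hne => absurd (hne ρ') (not_nonempty_iff.2 h)) fun he => he ρ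
  refine ⟨{
    obj := fun ρ => AnosovFree.freeGrpObj (C ρ)
    map := fun {ρ ρ'} f => AnosovFree.freeGrpHom (F C ρ ρ' f)
    map_id := fun ρ => (congrArg AnosovFree.freeGrpHom (AnosovFree.bundleMap_id (C ρ))).trans
      (AnosovFree.freeGrpHom_id (C ρ))
    map_comp := fun {ρ ρ' ρ''} f g =>
      (congrArg AnosovFree.freeGrpHom
        (F_comp C ρ ρ' ρ'' f g fun h => Or.inl (hE ρ ρ' h))).trans
      (AnosovFree.freeGrpHom_comp _ _) }, fun _ => rfl, fun ρ ρ' f => ?_⟩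
  simp only [eqToHom_refl, Category.id_comp, Category.comp_id]
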